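/- **Theorem (Minimality of $\mathrm{QC}$).** Vanilla quantum circuits form the prop generated by $H:1\to1$, $P(\varphi):1\to1$, $\mathrm{CNot}:2\to2$ and the global phases $s(\varphi):0\to0$, $\varphi\in\mathbb R$; $I$ denotes one wire, $\mathrm{swap}$ the symmetry on two wires. Sequential composition is written from left to right with "$;$", so $C_1;C_2=C_2\circ C_1$. Put * $R_X(\theta):=s(-\theta/2)\otimes(H;P(\theta);H)$ and $\mathrm{NotC}:=\mathrm{swap};\mathrm{CNot};\mathrm{swap}$; * $\Lambda^0P(\varphi):=P(\varphi)$, and $\Lambda^{k+1}P(\varphi):k+2\to k+2$ is the composite, in this order, of $\Lambda^kP(\varphi/2)$ on the first $k+1$ wires; $\Lambda^kP(\varphi/2)$ on the first $k$ wires and the last one; $\mathrm{CNot}$ from wire $k+1$ to wire $k+2$; $\Lambda^kP(-\varphi/2)$ on the first $k$ wires and the last one; $\mathrm{CNot}$ from wire $k+1$ to wire $k+2$. The equational theory $\mathrm{QC}$ consists of the following equations: * $(S_{2\pi})$ $\ s(2\pi)=\text{empty circuit}$; * $(S_+)$ $\ s(\varphi_1)\otimes s(\varphi_2)=s(\varphi_1+\varphi_2)$,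 for all $\varphi_1,\varphi_2\in\mathbb R$; * $(H^2)$ $\ H;H=I$; * $(P_0)$ $\ P(0)=I$; * $(C)$ $\ \mathrm{CNot};(P(\varphi)\otimes I);\mathrm{CNot}=P(\varphi)\otimes I$, for all $\varphi\in\mathbb R$; * $(B)$ $\ \mathrm{CNot};\mathrm{NotC}=\mathrm{swap};\mathrm{CNot}$; * $(CZ)$ $\ (I\otimes H);\mathrm{CNot};(I\otimes H)=(P(\tfrac\pi2)\otimes P(\tfrac\pi2));\mathrm{CNot};(I\otimes P(-\tfrac\pi2));\mathrm{CNot}$; * $(E_H)$ $\ H=P(\tfrac\pi2);R_X(\tfrac\pi2);P(\tfrac\pi2)$; * $(E)$ $\ R_X(\alpha_1);P(\alpha_2);R_X(\alpha_3)=s(\beta_0)\otimes(P(\beta_1);R_X(\beta_2);P(\beta_3))$, for all $\alpha_1,\alpha_2,\alpha_3\in\mathbb R$, where the $\beta_j\in[0,2\pi)$ are given modulo $2\pi$ as follows. Let $z=\cos\frac{\alpha_2}2\cos\frac{\alpha_1+\alpha_3}2+i\sin\frac{\alpha_2}2\cos\frac{\alpha_1-\alpha_3}2$ and $z'=\cos\frac{\alpha_2}2\sin\frac{\alpha_1+\alpha_3}2-i\sin\frac{\alpha_2}2\sin\frac{\alpha_1-\alpha_3}2$.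 If $z'=0$ then $\beta_0=\frac{\alpha_2}2-\arg z$, $\beta_1=2\arg z$, $\beta_2=\beta_3=0$. If $z=0$ then $\beta_0=\frac{\alpha_2}2-\arg z'$, $\beta_1=2\arg z'$, $\beta_2=\pi$, $\beta_3=0$. Otherwise $\beta_0=\frac{\alpha_2}2-\arg z$, $\beta_1=\arg z+\arg z'$, $\beta_2=2\arg(i+|z/z'|)$, $\beta_3=\arg z-\arg z'$; * $(I_n)$ $\ \Lambda^{n-1}P(2\pi)=I^{\otimes n}$, one equation for each $n\ge3$. Here $C=D$ is *derivable* from a set of equations if $C$ can be transformed into $D$ using only these equations (inside any circuit, in both directions) and the equations that hold in every prop. Then $\mathrm{QC}$ is minimal: none of the equations $(S_{2\pi})$, $(S_+)$, $(H^2)$, $(P_0)$, $(C)$, $(B)$, $(CZ)$, $(E_H)$, $(E)$, and $(I_n)$ for any $n\ge3$, can be derived from all the others. For the parametrised equations $(S_+)$, $(C)$, $(E)$ this means that not all their instances are derivable from (all instances of) the other equations; each $(I_n)$ is not derivable from the other equations together with all $(I_m)$, $m\ne n$, $m\geq 3$. -/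

import Mathlib

/-- Terms for the circuits `n → m` of the prop generated by `H : 1 → 1`, `P(φ) : 1 → 1`,
`CNot : 2 → 2` and the global phases `s(φ) : 0 → 0` (`φ ∈ ℝ`). Circuits proper are these terms up to
the deformation rules of props, which are part of the derivability relation `Derives` below. -/
inductive Circuit : ℕ → ℕ → Type
  | empty : Circuit 0 0
  | wire : Circuit 1 1
  | swap : Circuit 2 2
  | H : Circuit 1 1
  | P (φ : ℝ) : Circuit 1 1
  | cnot : Circuit 2 2
  | s (φ : ℝ) : Circuit 0 0
  /-- `seq C₁ C₂` is `C₂ ∘ C₁`: first `C₁`, then `C₂`. -/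
  | seq {n m k : ℕ} (C₁ : Circuit n m) (C₂ : Circuit m k) : Circuit n k
  /-- `par C₁ C₂` is `C₁ ⊗ C₂`: `C₁` on the upper wires, `C₂` on the lower wires. -/
  | par {n₁ m₁ n₂ m₂ : ℕ} (C₁ : Circuit n₁ m₁) (C₂ : Circuit n₂ m₂) : Circuit (n₁ + n₂) (m₁ + m₂)

namespace Circuit

/-- Diagrammatic composition: `C₁ ⨟ C₂` is `C₂ ∘ C₁`. -/
infixl:60 " ⨟ " => Circuit.seq

/-- Parallel composition. -/
infixl:70 " ⊠ " => Circuit.par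

/-- Transport of a circuit along equalities of the numbers of wires. -/
def cast {n m n' m' : ℕ} (hn : n = n') (hm : m = m') (C : Circuit n m) : Circuit n' m' :=
  hn ▸ hm ▸ C

/-- The identity on `n` wires: `I^{⊗ 0}` is empty and `I^{⊗ (k+1)} = I ⊗ I^{⊗ k}`. -/
def wires : (n : ℕ) → Circuit n n
  | 0 => empty
  | k + 1 => cast (Nat.add_comm 1 k) (Nat.add_comm 1 k) (wire ⊠ wires k)

/-- The circuit `σ_k`, which moves the last of `k + 1` wires to the top:
`σ_0 = I` and `σ_{k+1} = (swap ⊗ I^{⊗ k}) ∘ (I ⊗ σ_k)`. -/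
def sigma : (k : ℕ) → Circuit (k + 1) (1 + k)
  | 0 => wire
  | k + 1 =>
      cast (by omega) rfl (wire ⊠ sigma k) ⨟ cast (by omega) (by omega) (swap ⊠ wires k)

/-- The `X`-rotation `R_X(θ)`: a global phase `s(-θ/2)` next to `H`, `P(θ)`, `H`. -/
noncomputable def RX (θ : ℝ) : Circuit 1 1 :=
  cast (Nat.zero_add 1) (Nat.zero_add 1) (s (-θ / 2) ⊠ (H ⨟ P θ ⨟ H))

/-- The CNot gate with its control on the lower wire. -/
def notc : Circuit 2 2 := swap ⨟ cnot ⨟ swap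

/-- A circuit `C` on `k + 1` wires applied to the first `k` and the last of `k + 2` wires. -/
def skipWire {k : ℕ} (C : Circuit (k + 1) (k + 1)) : Circuit (k + 2) (k + 2) :=
  let σ : Circuit (k + 2) (k + 2) := wires k ⊠ swap
  let C' : Circuit (k + 1 + 1) (k + 1 + 1) := C ⊠ wire
  σ ⨟ C' ⨟ σ

/-- The multi-controlled phase gate with `k` controls, on `k + 1` wires, the target being the last
wire. The gate with `k + 1` controls, the last control being `c` and the target `t`, is composed
of: the gate `P(φ/2)` on `c`, the gate `P(φ/2)` on `t`, a CNot from `c` to `t`, the gate `P(-φ/2)`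
on `t`, and again a CNot from `c` to `t`; all three phase gates are controlled by the first `k`
wires. -/
noncomputable def ctrlP : (k : ℕ) → ℝ → Circuit (k + 1) (k + 1)
  | 0, φ => P φ
  | k + 1, φ =>
      let cx : Circuit (k + 2) (k + 2) := wires k ⊠ cnot
      (ctrlP k (φ / 2) ⊠ wire) ⨟ skipWire (ctrlP k (φ / 2)) ⨟ cx ⨟ skipWire (ctrlP k (-φ / 2)) ⨟ cx

end Circuit

open Circuit in
/-- `Derives Γ C D`: the circuit `C` can be transformed into `D` using only the equations of `Γ`
together with the deformation rules of props. -/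
inductive Derives (Γ : ∀ ⦃n m : ℕ⦄, Circuit n m → Circuit n m → Prop) :
    ∀ {n m : ℕ}, Circuit n m → Circuit n m → Prop
  -- the equations of the theory, closed under equivalence and context
  | ax {n m : ℕ} {C D : Circuit n m} (h : Γ C D) : Derives Γ C D
  | refl {n m : ℕ} (C : Circuit n m) : Derives Γ C C
  | symm {n m : ℕ} {C D : Circuit n m} (h : Derives Γ C D) : Derives Γ D C
  | trans {n m : ℕ} {C D E : Circuit n m} (h₁ : Derives Γ C D) (h₂ : Derives Γ D E) : Derives Γ C E
  | seq_congr {n m k : ℕ} {C C' : Circuit n m} {D D' : Circuit m k}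
      (h₁ : Derives Γ C C') (h₂ : Derives Γ D D') : Derives Γ (C ⨟ D) (C' ⨟ D')
  | par_congr {n₁ m₁ n₂ m₂ : ℕ} {C C' : Circuit n₁ m₁} {D D' : Circuit n₂ m₂}
      (h₁ : Derives Γ C C') (h₂ : Derives Γ D D') : Derives Γ (C ⊠ D) (C' ⊠ D')
  -- the deformation rules
  | seq_assoc {n m k l : ℕ} (C₁ : Circuit n m) (C₂ : Circuit m k) (C₃ : Circuit k l) :
      Derives Γ (C₁ ⨟ C₂ ⨟ C₃) (C₁ ⨟ (C₂ ⨟ C₃))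
  | par_assoc {n₁ m₁ n₂ m₂ n₃ m₃ : ℕ}
      (C₁ : Circuit n₁ m₁) (C₂ : Circuit n₂ m₂) (C₃ : Circuit n₃ m₃) :
      Derives Γ (Circuit.cast (Nat.add_assoc n₁ n₂ n₃) (Nat.add_assoc m₁ m₂ m₃) (C₁ ⊠ C₂ ⊠ C₃))
        (C₁ ⊠ (C₂ ⊠ C₃))
  | interchange {n₁ m₁ k₁ n₂ m₂ k₂ : ℕ} (C₁ : Circuit n₁ m₁) (C₂ : Circuit n₂ m₂)
      (C₃ : Circuit m₁ k₁) (C₄ : Circuit m₂ k₂) :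
      Derives Γ ((C₁ ⊠ C₂) ⨟ (C₃ ⊠ C₄)) ((C₁ ⨟ C₃) ⊠ (C₂ ⨟ C₄))
  | par_empty {n m : ℕ} (C : Circuit n m) : Derives Γ (C ⊠ empty) C
  | empty_par {n m : ℕ} (C : Circuit n m) :
      Derives Γ (Circuit.cast (Nat.zero_add n) (Nat.zero_add m) (empty ⊠ C)) C
  | wires_seq {n m : ℕ} (C : Circuit n m) : Derives Γ (wires n ⨟ C) C
  | seq_wires {n m : ℕ} (C : Circuit n m) : Derives Γ (C ⨟ wires m) C
  | swap_swap : Derives Γ (swap ⨟ swap) (wire ⊠ wire)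
  | naturality {n m : ℕ} (C : Circuit n m) :
      Derives Γ ((C ⊠ wire) ⨟ sigma m) (sigma n ⨟ (wire ⊠ C))

/-- An equational theory given as a family of rules, a rule being the collection of its instances,
is minimal if no rule `r` can be derived from the others: not all the instances of `r` are
derivable from the instances of the other rules. -/
def IsMinimal {ι : Type} (T : ι → ∀ ⦃n m : ℕ⦄, Circuit n m → Circuit n m → Prop) : Prop :=
  ∀ r : ι, ¬ ∀ ⦃n m : ℕ⦄ (C D : Circuit n m), T r C D →
    Derives (fun _ _ C' D' => ∃ r' : ι, r' ≠ r ∧ T r' C' D') C D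

namespace QC

/-- Reduction of an angle modulo `2π` to the interval `[0, 2π)`. -/
noncomputable def mod2pi (x : ℝ) : ℝ := toIcoMod Real.two_pi_pos 0 x

/-- The complex number `z` attached to `α₁, α₂, α₃` in Euler's rule. -/
noncomputable def z (α₁ α₂ α₃ : ℝ) : ℂ :=
  ⟨Real.cos (α₂ / 2) * Real.cos ((α₁ + α₃) / 2), Real.sin (α₂ / 2) * Real.cos ((α₁ - α₃) / 2)⟩

/-- The complex number `z'` attached to `α₁, α₂, α₃` in Euler's rule. -/
noncomputable def z' (α₁ α₂ α₃ : ℝ) : ℂ :=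
  ⟨Real.cos (α₂ / 2) * Real.sin ((α₁ + α₃) / 2), -(Real.sin (α₂ / 2) * Real.sin ((α₁ - α₃) / 2))⟩

open Classical in
/-- The angle `β₀` of Euler's rule. -/
noncomputable def β₀ (α₁ α₂ α₃ : ℝ) : ℝ :=
  if z' α₁ α₂ α₃ = 0 then mod2pi (α₂ / 2 - (z α₁ α₂ α₃).arg)
  else if z α₁ α₂ α₃ = 0 then mod2pi (α₂ / 2 - (z' α₁ α₂ α₃).arg)
  else mod2pi (α₂ / 2 - (z α₁ α₂ α₃).arg)

open Classical in
/-- The angle `β₁` of Euler's rule. -/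
noncomputable def β₁ (α₁ α₂ α₃ : ℝ) : ℝ :=
  if z' α₁ α₂ α₃ = 0 then mod2pi (2 * (z α₁ α₂ α₃).arg)
  else if z α₁ α₂ α₃ = 0 then mod2pi (2 * (z' α₁ α₂ α₃).arg)
  else mod2pi ((z α₁ α₂ α₃).arg + (z' α₁ α₂ α₃).arg)

open Classical in
/-- The angle `β₂` of Euler's rule. -/
noncomputable def β₂ (α₁ α₂ α₃ : ℝ) : ℝ :=
  if z' α₁ α₂ α₃ = 0 then 0
  else if z α₁ α₂ α₃ = 0 then Real.pi
  else mod2pi (2 * (Complex.I + (‖z α₁ α₂ α₃ / z' α₁ α₂ α₃‖ : ℂ)).arg)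

open Classical in
/-- The angle `β₃` of Euler's rule. -/
noncomputable def β₃ (α₁ α₂ α₃ : ℝ) : ℝ :=
  if z' α₁ α₂ α₃ = 0 then 0
  else if z α₁ α₂ α₃ = 0 then 0
  else mod2pi ((z α₁ α₂ α₃).arg - (z' α₁ α₂ α₃).arg)

/-- The names of the rules of `QC`. The rule `(I)` counts as one rule for each number `k ≥ 2` of
controls, that is, for each number `k + 1 ≥ 3` of qubits. -/
inductive Rule : Type
  | S2pi
  | Splus
  | H2
  | P0
  | C
  | B
  | CZ
  | EH
  | E
  | I (k : ℕ) (hk : 2 ≤ k)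

open Circuit in
/-- The equational theory `QC`: `Eqn r C D` holds if `C = D` is an instance of the rule `r`. -/
inductive Eqn : Rule → ∀ ⦃n m : ℕ⦄, Circuit n m → Circuit n m → Prop
  | S2pi : Eqn .S2pi (s (2 * Real.pi)) empty
  | Splus (φ₁ φ₂ : ℝ) : Eqn .Splus (s φ₁ ⊠ s φ₂) (s (φ₁ + φ₂))
  | H2 : Eqn .H2 (H ⨟ H) wire
  | P0 : Eqn .P0 (P 0) wire
  | C (φ : ℝ) : Eqn .C (cnot ⨟ (P φ ⊠ wire) ⨟ cnot) (P φ ⊠ wire)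
  | B : Eqn .B (cnot ⨟ notc) (swap ⨟ cnot)
  | CZ : Eqn .CZ ((wire ⊠ H) ⨟ cnot ⨟ (wire ⊠ H))
      ((P (Real.pi / 2) ⊠ P (Real.pi / 2)) ⨟ cnot ⨟ (wire ⊠ P (-Real.pi / 2)) ⨟ cnot)
  | EH : Eqn .EH H (P (Real.pi / 2) ⨟ RX (Real.pi / 2) ⨟ P (Real.pi / 2))
  | E (α₁ α₂ α₃ : ℝ) : Eqn .E (RX α₁ ⨟ P α₂ ⨟ RX α₃)
      (Circuit.cast (Nat.zero_add 1) (Nat.zero_add 1)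
        (s (β₀ α₁ α₂ α₃) ⊠ (P (β₁ α₁ α₂ α₃) ⨟ RX (β₂ α₁ α₂ α₃) ⨟ P (β₃ α₁ α₂ α₃))))
  | I (k : ℕ) (hk : 2 ≤ k) : Eqn (.I k hk) (ctrlP k (2 * Real.pi)) (wires (k + 1))

end QC

namespace Circuit

/-! Each rule is separated from the others by an additive invariant: a sum of gate weights in a
commutative monoid. The prop rules preserve any such sum as soon as twice the weight of `swap`
vanishes. Since the number of wires is conserved, a derivation on at most `N` wires uses only
equations on at most `N` wires; `weight_eq_of_derives` thus lets all larger rules be ignored. For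
most rules the invariant is a parity, a count or the presence of a gate. For `I` it is a formal half
of the argument of the determinant, which `weight_ctrlP` evaluates. -/

/-- Circuits have as many outputs as inputs. -/
theorem inputs_eq_outputs {n m : ℕ} (C : Circuit n m) : n = m := by
  induction C <;> omega

/-! ### Additive invariants of circuits. -/

section Weight

variable {M : Type} [AddCommMonoid M]

/-- Weights of the generators and of the symmetry in a commutative monoid. -/
structure Weights (M : Type) where
  swap : M
  H : M
  P : ℝ → M
  cnot : M
  s : ℝ → M

/-- The total weight of the gates of a circuit. -/
def weight (w : Weights M) : {n m : ℕ} → Circuit n m → M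
  | _, _, empty => 0
  | _, _, wire => 0
  | _, _, swap => w.swap
  | _, _, H => w.H
  | _, _, P φ => w.P φ
  | _, _, cnot => w.cnot
  | _, _, s φ => w.s φ
  | _, _, seq C₁ C₂ => weight w C₁ + weight w C₂
  | _, _, par C₁ C₂ => weight w C₁ + weight w C₂

@[simp]
theorem weight_cast (w : Weights M) {n m n' m' : ℕ} (hn : n = n') (hm : m = m')
    (C : Circuit n m) : weight w (cast hn hm C) = weight w C := by
  subst hn hm
  rfl

@[simp]
theorem weight_wires (w : Weights M) (n : ℕ) : weight w (wires n) = 0 := by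
  induction n with
  | zero => rfl
  | succ n ih => simp [wires, weight, ih]

theorem weight_RX (w : Weights M) (θ : ℝ) :
    weight w (RX θ) = w.s (-θ / 2) + (w.H + w.P θ + w.H) := by
  simp [RX, weight]

/-- The weight is invariant under derivations between circuits on at most `N` wires if it is
invariant under the equations between such circuits. -/
theorem weight_eq_of_derives (w : Weights M) (N : ℕ)
    {Γ : ∀ ⦃n m : ℕ⦄, Circuit n m → Circuit n m → Prop}
    (hswap : 2 ≤ N → w.swap + w.swap = 0)
    (hΓ : ∀ ⦃n m : ℕ⦄ (C D : Circuit n m), n ≤ N → Γ C D → weight w C = weight w D)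
    {n m : ℕ} {C D : Circuit n m} (h : Derives Γ C D) (hn : n ≤ N) :
    weight w C = weight w D := by
  induction h with
  | ax h => exact hΓ _ _ hn h
  | refl => rfl
  | symm _ ih => exact (ih hn).symm
  | trans _ _ ih₁ ih₂ => exact (ih₁ hn).trans (ih₂ hn)
  | @seq_congr n m k C C' D D' h₁ h₂ ih₁ ih₂ =>
    have := C.inputs_eq_outputs
    simp only [weight, ih₁ hn, ih₂ (this ▸ hn)]
  | par_congr _ _ ih₁ ih₂ => simp only [weight, ih₁ (by omega), ih₂ (by omega)]
  | seq_assoc => simp only [weight, add_assoc]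
  | par_assoc => simp only [weight_cast, weight, add_assoc]
  | interchange => simp only [weight, add_add_add_comm]
  | par_empty => simp only [weight, add_zero]
  | empty_par => simp only [weight_cast, weight, zero_add]
  | wires_seq => simp only [weight, weight_wires, zero_add]
  | seq_wires => simp only [weight, weight_wires, add_zero]
  | swap_swap => simpa only [weight, add_zero] using hswap hn
  | naturality C =>
    -- Both sides now contain the same `sigma`, so its weight need not be computed.
    obtain rfl := C.inputs_eq_outputs
    simp only [weight, add_zero, add_comm]

end Weight

end Circuit

namespace QC

open Circuit

/-- To separate a rule from the others it suffices to find weights and a bound `N` on the number of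
wires such that the other rules preserve the weight on at most `N` wires, but the rule does not. -/
theorem not_derives_of_weight {M : Type} [AddCommMonoid M] (w : Weights M) (N : ℕ) {r : Rule}
    (hswap : 2 ≤ N → w.swap + w.swap = 0)
    (hr : ∀ ⦃r' : Rule⦄ ⦃n m : ℕ⦄ ⦃C D : Circuit n m⦄, Eqn r' C D → r' ≠ r → n ≤ N →
      weight w C = weight w D)
    {n m : ℕ} {C D : Circuit n m} (hn : n ≤ N) (hCD : Eqn r C D)
    (hne : weight w C ≠ weight w D) :
    ¬ ∀ ⦃n m : ℕ⦄ (C D : Circuit n m), Eqn r C D →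
      Derives (fun _ _ C' D' => ∃ r' : Rule, r' ≠ r ∧ Eqn r' C' D') C D := fun h =>
  hne (weight_eq_of_derives w N hswap
    (fun _ _ _ _ hn ⟨_, hr', he⟩ => hr he hr' hn) (h C D hCD) hn)

/-! ### The half-determinant. -/

/-- Euler's rule compared on determinants: X-rotations have determinant 1, and a global phase counts
twice on one wire. -/
theorem two_nsmul_β₀_add_β₁_add_β₃ (α₁ α₂ α₃ : ℝ) :
    2 • (β₀ α₁ α₂ α₃ : Real.Angle) + β₁ α₁ α₂ α₃ + β₃ α₁ α₂ α₃ = α₂ := by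
  have key : ∀ x : ℝ, ((mod2pi x : ℝ) : Real.Angle) = x := fun x => Real.Angle.coe_toIcoMod x 0
  unfold β₀ β₁ β₃
  split_ifs <;> simp only [key, ← Real.Angle.coe_nsmul, ← Real.Angle.coe_add,
    Real.Angle.coe_zero, add_zero] <;> congr 1 <;> simp only [nsmul_eq_mul] <;> push_cast <;> ring

/-- Half of the argument of the determinant of a generator extended by identities to `j + 3` wires,
computed formally from the angles: the logarithm of the determinant is additive modulo `2π`, and its
formal half is preserved by all equations on at most `j + 3` wires but `Λ^{j+2}P(2π) = I`. -/
noncomputable def halfDetWeights (j : ℕ) : Weights Real.Angle where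
  swap := 2 ^ j • (Real.pi : Real.Angle)
  H := 0
  P φ := 2 ^ (j + 1) • (φ : Real.Angle)
  cnot := 2 ^ j • (Real.pi : Real.Angle)
  s φ := 2 ^ (j + 2) • (φ : Real.Angle)

theorem two_pow_nsmul_pi_add_self (j : ℕ) :
    2 ^ j • (Real.pi : Real.Angle) + 2 ^ j • (Real.pi : Real.Angle) = 0 := by
  rw [← nsmul_add, ← two_nsmul, Real.Angle.two_nsmul_coe_pi, nsmul_zero]

theorem weight_skipWire {M : Type} [AddCommMonoid M] (w : Weights M)
    (hswap : w.swap + w.swap = 0) {k : ℕ} (C : Circuit (k + 1) (k + 1)) :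
    weight w (skipWire C) = weight w C := by
  simp only [skipWire, weight, weight_wires, zero_add, add_zero]
  rw [add_right_comm, hswap, zero_add]

/-- Each new control halves the angle: the two CNots cancel, and φ/2 + φ/2 - φ/2 = φ/2. -/
theorem weight_ctrlP (j k : ℕ) (φ : ℝ) :
    weight (halfDetWeights j) (ctrlP k φ) = ((2 ^ (j + 1) * (φ / 2 ^ k) : ℝ) : Real.Angle) := by
  induction k generalizing φ with
  | zero => simp [ctrlP, weight, halfDetWeights, ← Real.Angle.coe_nsmul]
  | succ k ih =>
    have hc := two_pow_nsmul_pi_add_self j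
    have hx : (halfDetWeights j).cnot = 2 ^ j • (Real.pi : Real.Angle) := rfl
    simp only [ctrlP, weight, weight_wires, zero_add, add_zero,
      weight_skipWire (halfDetWeights j) hc, ih, hx]
    rw [add_right_comm _ (2 ^ j • _), add_assoc _ (2 ^ j • _), hc, add_zero, ← Real.Angle.coe_add,
      ← Real.Angle.coe_add]
    congr 1
    rw [pow_succ 2 k]
    field_simp
    ring

theorem weight_halfDet_eq (j : ℕ) {r : Rule} {n m : ℕ} {C D : Circuit n m} (h : Eqn r C D)
    (hr : r ≠ .I (j + 2) (by omega)) (hn : n ≤ j + 3) :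
    weight (halfDetWeights j) C = weight (halfDetWeights j) D := by
  have hc := two_pow_nsmul_pi_add_self j
  have hRX : ∀ θ, weight (halfDetWeights j) (RX θ) = 0 := by
    intro θ
    simp only [weight_RX, halfDetWeights, zero_add, add_zero, ← Real.Angle.coe_nsmul,
      ← Real.Angle.coe_add]
    rw [← Real.Angle.coe_zero]
    congr 1
    simp only [nsmul_eq_mul]
    push_cast
    ring
  have hhalf : 2 ^ (j + 1) • ((Real.pi / 2 : ℝ) : Real.Angle) = 2 ^ j • (Real.pi : Real.Angle) := by
    simp only [← Real.Angle.coe_nsmul]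
    congr 1
    simp only [nsmul_eq_mul]
    push_cast
    ring
  cases h with
  | S2pi => simp [weight, halfDetWeights]
  | Splus => simp [weight, halfDetWeights]
  | H2 => simp [weight, halfDetWeights]
  | P0 => simp [weight, halfDetWeights]
  | C φ =>
    simp only [weight, halfDetWeights, add_zero]
    rw [add_right_comm, hc, zero_add]
  | B =>
    simp only [weight, halfDetWeights, notc]
    rw [hc, zero_add, hc]
  | CZ =>
    simp only [weight, halfDetWeights, hhalf, hc, zero_add, add_zero, neg_div, Real.Angle.coe_neg]
    rw [neg_nsmul, hhalf, add_neg_cancel, zero_add]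
  | EH => simp only [weight, hRX, add_zero]; simp only [halfDetWeights, hhalf, hc]
  | E α₁ α₂ α₃ =>
    simp only [weight_cast, weight, hRX, add_zero, zero_add]
    simp only [halfDetWeights]
    rw [← two_nsmul_β₀_add_β₁_add_β₃ α₁ α₂ α₃, nsmul_add, nsmul_add, ← mul_nsmul', ← pow_succ,
      add_assoc]
  | I k hk =>
    have hk' : k ≠ j + 2 := by
      rintro rfl
      exact hr rfl
    -- The wire bound and `hk'` force k ≤ j + 1, so the weight is a multiple of 2π.
    obtain ⟨i, hi⟩ : ∃ i, j + 1 = k + i := ⟨j + 1 - k, by omega⟩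
    rw [weight_ctrlP, weight_wires, hi]
    have : (2 ^ (k + i) * (2 * Real.pi / 2 ^ k) : ℝ) = (2 ^ i : ℕ) • (2 * Real.pi) := by
      simp only [nsmul_eq_mul]
      push_cast
      field_simp
      rw [pow_add]
    rw [this, Real.Angle.coe_nsmul, Real.Angle.coe_two_pi, nsmul_zero]

end QC

/-! ### The invariant for each rule. -/

open Circuit QC in
theorem mainTheorem2 : IsMinimal QC.Eqn := by
  intro r
  cases r with
  | S2pi =>
    -- The total phase, not reduced modulo 2π.
    refine not_derives_of_weight (M := ℝ) ⟨0, 0, 0, 0, id⟩ 0 (by simp) ?_ le_rfl .S2pi ?_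
    · intro r' n m C D h hr hn
      cases h <;> first | omega | simp_all [weight]
    · simp [weight, Real.pi_ne_zero]
  | Splus =>
    classical
    -- The number of phases other than `s (2π)`.
    refine not_derives_of_weight (M := ℕ) ⟨0, 0, 0, 0, fun φ => if φ = 2 * Real.pi then 0 else 1⟩
      0 (by simp) ?_ le_rfl (.Splus 0 0) ?_
    · intro r' n m C D h hr hn
      cases h <;> first | omega | simp_all [weight]
    · simp [weight]
  | H2 =>
    -- As ⊤ is absorbing, this detects whether `H` occurs at all.
    refine not_derives_of_weight (M := ℕ∞) ⟨0, ⊤, 0, 0, 0⟩ 1 (by simp) ?_ le_rfl .H2 ?_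
    · intro r' n m C D h hr hn
      cases h <;> first | omega | simp_all [weight, weight_RX]
    · simp [weight]
  | P0 =>
    -- `RX` is odd, having two `H` and one `P`.
    refine not_derives_of_weight (M := ZMod 2) ⟨0, 1, 1, 0, 0⟩ 1 (by simp) ?_ le_rfl .P0 ?_
    · intro r' n m C D h hr hn
      cases h <;> first | omega | simp_all [weight, weight_RX] <;> rfl
    · simp [weight]
  | C =>
    refine not_derives_of_weight (M := ℕ∞) ⟨0, 0, 0, ⊤, 0⟩ 2 (by simp) ?_ le_rfl (.C 0) ?_
    · intro r' n m C D h hr hn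
      cases h <;> first | omega | simp_all [weight, weight_RX]
    · simp [weight]
  | B =>
    refine not_derives_of_weight (M := ZMod 2) ⟨1, 0, 0, 0, 0⟩ 2 (fun _ => rfl) ?_ le_rfl .B ?_
    · intro r' n m C D h hr hn
      cases h <;> first | omega | simp_all [weight, weight_RX]
    · simp [weight, notc]
  | CZ =>
    -- Counting swaps along with CNots makes both sides of `B` even.
    refine not_derives_of_weight (M := ZMod 2) ⟨1, 0, 0, 1, 0⟩ 2 (fun _ => rfl) ?_ le_rfl .CZ ?_
    · intro r' n m C D h hr hn
      cases h <;> first | omega | simp_all [weight, weight_RX, notc] <;> rfl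
    · simp [weight]
  | EH =>
    refine not_derives_of_weight (M := ZMod 2) ⟨0, 1, 0, 0, 0⟩ 1 (by simp) ?_ le_rfl .EH ?_
    · intro r' n m C D h hr hn
      cases h <;> first | omega | simp_all [weight, weight_RX] <;> rfl
    · simp [weight, weight_RX]
  | E =>
    classical
    -- Counts `P (2π)`, which `E` can remove because its output angles lie in [0, 2π).
    refine not_derives_of_weight (M := ℕ) ⟨0, 0, fun φ => if φ = 2 * Real.pi then 1 else 0, 0, 0⟩
      1 (by simp) ?_ le_rfl (.E 0 (2 * Real.pi) 0) ?_
    · intro r' n m C D h hr hn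
      have h2 : Real.pi / 2 ≠ 2 * Real.pi := by linarith [Real.pi_pos]
      cases h <;> first | omega | simp_all [weight, weight_RX]
    · have hz' : z' 0 (2 * Real.pi) 0 = 0 := by simp [z', Complex.ext_iff]
      have h1 : β₁ 0 (2 * Real.pi) 0 ≠ 2 * Real.pi := by
        rw [β₁, if_pos hz']
        have := toIcoMod_lt_right Real.two_pi_pos 0
          (2 * (z 0 (2 * Real.pi) 0).arg)
        rw [zero_add] at this
        exact this.ne
      simp [weight, weight_RX, β₂, β₃, hz', h1]
  | I k hk =>
    obtain ⟨j, rfl⟩ : ∃ j, k = j + 2 := ⟨k - 2, by omega⟩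
    refine not_derives_of_weight (halfDetWeights j) (j + 3)
      (fun _ => two_pow_nsmul_pi_add_self j)
      (fun _ _ _ _ _ h hr hn => weight_halfDet_eq j h hr hn) le_rfl (.I (j + 2) hk) ?_
    -- With j + 2 controls one factor 2 is missing, leaving π ≠ 0.
    have : (2 ^ (j + 1) * (2 * Real.pi / 2 ^ (j + 2)) : ℝ) = Real.pi := by
      field_simp
      ring
    rw [weight_ctrlP, weight_wires, this]
    exact Real.Angle.pi_ne_zero
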